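/- There are absolute constants $C, c > 0$ such that the following holds. Call a finite set of points in the Euclidean plane in strictly convex position if no point of the set lies in the convex hull of the others. A minimum-area triangle determined by a finite set $S$ of points in the plane is a triangle with vertices in $S$ whose area is nonzero and is the minimum of all nonzero areas of triangles with vertices in $S$. (i) Every set of $n$ points in strictly convex position in the plane determines at most $Cn$ minimum-area triangles. (ii) This bound is asymptotically tight: for every $n \ge 3$ there is a set of $n$ points in strictly convex position in the plane that determines at least $cn$ minimum-area triangles. In fact, for every $n \ge 4$, the $n$ vertices of a regular $n$-gon are in strictly convex position and determine exactly $n$ minimum-area triangles. -/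

import Mathlib

/-- The Euclidean plane. -/
abbrev Plane : Type := EuclideanSpace ℝ (Fin 2)

/-- The (unsigned) area of the possibly degenerate triangle with vertices `p`, `q`, `r`. -/
noncomputable def triangleArea (p q r : Plane) : ℝ :=
  |(q 0 - p 0) * (r 1 - p 1) - (r 0 - p 0) * (q 1 - p 1)| / 2

/-- A finite set of points is in strictly convex position if no point of the set lies in the
convex hull of the other ones. -/
def InStrictlyConvexPosition (S : Finset Plane) : Prop :=
  ConvexIndependent ℝ (fun p : S => (p : Plane))

/-- `T` is the vertex set of a nondegenerate triangle spanned by `S` whose area is minimum among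
all nondegenerate triangles spanned by `S`. -/
def IsMinAreaTriangle (S T : Finset Plane) : Prop :=
  ∃ a ∈ S, ∃ b ∈ S, ∃ c ∈ S, (T : Set Plane) = {a, b, c} ∧ 0 < triangleArea a b c ∧
    ∀ x ∈ S, ∀ y ∈ S, ∀ z ∈ S, 0 < triangleArea x y z → triangleArea a b c ≤ triangleArea x y z

open Classical in
/-- The minimum-area triangles determined by `S`, each given by its vertex set. -/
noncomputable def minAreaTriangles (S : Finset Plane) : Finset (Finset Plane) :=
  S.powerset.filter (fun T => IsMinAreaTriangle S T)

open Classical in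
/-- The vertex set of the regular `n`-gon inscribed in the unit circle. -/
noncomputable def regularPolygon (n : ℕ) : Finset Plane :=
  (Finset.range n).image
    (fun k => !₂[Real.cos (2 * Real.pi * k / n), Real.sin (2 * Real.pi * k / n)])

/-! A minimum-area triangle `a b c` has at most one side that is not a hull edge. If points `x` and
`y` lay beyond `a b` and `b c`, minimality would make both at least as far from line `c a` as `b`,
and then `b` would be a convex combination of `x`, `a`, `y`, `c`
(`InStrictlyConvexPosition.isHullEdge_or_isHullEdge`). So the triangle consists of three consecutive
hull vertices and is determined by the middle one, which gives at most `n` triangles.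

For the regular `n`-gon the area is a product of three sines of half central angles
(`orientation_polygonVertex`). A nondegenerate triangle has three sides at least as long as a
polygon side, one of them at least as long as a chord of step 2. Hence all `n` consecutive triples
attain the minimum, and they are distinct once `n ≥ 4`. -/

/-! ### Signed areas and convex position. -/

/-- Twice the signed area of the triangle `p`, `q`, `r`. -/
noncomputable def orientation (p q r : Plane) : ℝ :=
  (q 0 - p 0) * (r 1 - p 1) - (r 0 - p 0) * (q 1 - p 1)

theorem triangleArea_eq (p q r : Plane) : triangleArea p q r = |orientation p q r| / 2 := rfl

theorem orientation_rotate (p q r : Plane) : orientation q r p = orientation p q r := by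
  unfold orientation; ring

theorem orientation_swap (p q r : Plane) : orientation p r q = -orientation p q r := by
  unfold orientation; ring

theorem inStrictlyConvexPosition_iff (S : Finset Plane) :
    InStrictlyConvexPosition S ↔ ∀ x ∈ S, x ∉ convexHull ℝ ((S : Set Plane) \ {x}) :=
  convexIndependent_set_iff_notMem_convexHull_sdiff (s := (S : Set Plane))

/-- No point of a set in strictly convex position is a nontrivial weighted mean of four others. -/
theorem InStrictlyConvexPosition.not_weighted_mean {S : Finset Plane}
    (hS : InStrictlyConvexPosition S) {p x y z w : Plane} (hp : p ∈ S)
    (hx : x ∈ S) (hy : y ∈ S) (hz : z ∈ S) (hw : w ∈ S)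
    (hxp : x ≠ p) (hyp : y ≠ p) (hzp : z ≠ p) (hwp : w ≠ p) {α β γ δ : ℝ}
    (hα : 0 ≤ α) (hβ : 0 ≤ β) (hγ : 0 ≤ γ) (hδ : 0 ≤ δ) (hpos : 0 < α + β + γ + δ)
    (h0 : α * x 0 + β * y 0 + γ * z 0 + δ * w 0 = (α + β + γ + δ) * p 0)
    (h1 : α * x 1 + β * y 1 + γ * z 1 + δ * w 1 = (α + β + γ + δ) * p 1) : False := by
  refine (inStrictlyConvexPosition_iff S).1 hS p hp ?_
  set σ := α + β + γ + δ with hσ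
  have hc := convex_convexHull ℝ ((S : Set Plane) \ {p})
  have hmem : ∀ q ∈ S, q ≠ p → q ∈ convexHull ℝ ((S : Set Plane) \ {p}) := fun q hq hqp =>
    subset_convexHull ℝ _ ⟨hq, hqp⟩
  have hsum := hc.sum_mem (t := Finset.univ) (w := ![α / σ, β / σ, γ / σ, δ / σ])
    (z := ![x, y, z, w])
    (by
      intro i _
      fin_cases i <;> simp <;> positivity)
    (by
      simp [Fin.sum_univ_four]
      field_simp
      exact hσ.symm)
    (by
      intro i _
      fin_cases i
      exacts [hmem x hx hxp, hmem y hy hyp, hmem z hz hzp, hmem w hw hwp])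
  convert hsum using 1
  ext i
  fin_cases i
  · simp [Fin.sum_univ_four]
    field_simp
    linarith
  · simp [Fin.sum_univ_four]
    field_simp
    linarith

/-- The three signed areas are the unnormalised barycentric coordinates of `x`; `orientation_add`
gives their sum. The weighted means built from triangles below come from these two identities. -/
theorem orientation_barycentric (a b c x : Plane) (i : Fin 2) :
    orientation b c x * a i + orientation c a x * b i + orientation a b x * c i =
      orientation a b c * x i := by
  fin_cases i <;> simp [orientation] <;> ring

theorem orientation_add (a b c x : Plane) :
    orientation b c x + orientation c a x + orientation a b x = orientation a b c := by
  unfold orientation; ring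

theorem ne_of_orientation_ne_zero {a b c : Plane} (h : orientation a b c ≠ 0) :
    a ≠ b ∧ b ≠ c ∧ c ≠ a := by
  refine ⟨?_, ?_, ?_⟩ <;> rintro rfl <;> exact h (by unfold orientation; ring)

/-- A point of a set in strictly convex position does not lie in the closed cone opposite to a
triangle at one of its vertices. -/
theorem InStrictlyConvexPosition.orientation_pos {S : Finset Plane}
    (hS : InStrictlyConvexPosition S) {a b c x : Plane} (ha : a ∈ S) (hb : b ∈ S) (hc : c ∈ S)
    (hx : x ∈ S) (habc : 0 < orientation a b c) (h : orientation a b x < 0) :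
    0 < orientation c a x := by
  by_contra! hneg
  obtain ⟨hab, -, hca⟩ := ne_of_orientation_ne_zero habc.ne'
  obtain ⟨-, -, hxa⟩ := ne_of_orientation_ne_zero h.ne
  have hadd := orientation_add a b c x
  have h0 := orientation_barycentric a b c x 0
  have h1 := orientation_barycentric a b c x 1
  -- Solving the barycentric identity for `a` gives nonnegative weights on `x`, `b`, `c`.
  refine hS.not_weighted_mean ha hx hb hc hc hxa hab.symm hca hca
    (α := orientation a b c) (β := -orientation c a x) (γ := -orientation a b x) (δ := 0)
    (by linarith) (by linarith) (by linarith) le_rfl (by linarith) ?_ ?_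
  · rw [← hadd] at h0 ⊢; linarith
  · rw [← hadd] at h1 ⊢; linarith

/-- No three points of a set in strictly convex position are collinear. -/
theorem InStrictlyConvexPosition.orientation_ne_zero {S : Finset Plane}
    (hS : InStrictlyConvexPosition S) {a b c : Plane} (ha : a ∈ S) (hb : b ∈ S) (hc : c ∈ S)
    (hab : a ≠ b) (hbc : b ≠ c) (hca : c ≠ a) : orientation a b c ≠ 0 := by
  intro h
  obtain ⟨i, hi⟩ : ∃ i, a i ≠ b i := by
    by_contra! hcon
    exact hab (by ext i; exact hcon i)
  have key : ∀ j, (b i - a i) * (c j - a j) = (c i - a i) * (b j - a j) := by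
    intro j
    unfold orientation at h
    fin_cases i <;> fin_cases j <;> simp <;> linarith
  have hd : b i - a i ≠ 0 := sub_ne_zero.2 hi.symm
  obtain ⟨t, ht⟩ : ∃ t, t = (c i - a i) / (b i - a i) := ⟨_, rfl⟩
  have hc' : ∀ j, c j = (1 - t) * a j + t * b j := by
    intro j
    have hk := key j
    rw [ht]
    field_simp
    linarith
  have h0 := hc' 0
  have h1 := hc' 1
  -- According to the position of `t` relative to 0 and 1, the point between the other two is `a`,
  -- `c` or `b`.
  rcases lt_or_ge t 0 with ht0 | ht0
  · refine hS.not_weighted_mean ha hc hb hb hb hca hab.symm hab.symm hab.symm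
      (α := 1) (β := -t) (γ := 0) (δ := 0) zero_le_one (by linarith) le_rfl le_rfl
      (by linarith) ?_ ?_ <;> linarith
  rcases le_or_gt t 1 with ht1 | ht1
  · refine hS.not_weighted_mean hc ha hb hb hb hca.symm hbc hbc hbc
      (α := 1 - t) (β := t) (γ := 0) (δ := 0) (by linarith) ht0 le_rfl le_rfl
      (by linarith) ?_ ?_ <;> linarith
  · refine hS.not_weighted_mean hb hc ha ha ha hbc.symm hab hab hab
      (α := 1) (β := t - 1) (γ := 0) (δ := 0) zero_le_one (by linarith) le_rfl le_rfl
      (by linarith) ?_ ?_ <;> linarith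

/-! ### Hull edges and the upper bound. -/

/-- `(a, b)` is an edge of the convex hull of `S`, oriented counterclockwise. -/
def IsHullEdge (S : Finset Plane) (a b : Plane) : Prop :=
  a ∈ S ∧ b ∈ S ∧ a ≠ b ∧ ∀ x ∈ S, 0 ≤ orientation a b x

theorem InStrictlyConvexPosition.isHullEdge_right_unique {S : Finset Plane}
    (hS : InStrictlyConvexPosition S) {a b c : Plane} (hb : IsHullEdge S a b)
    (hc : IsHullEdge S a c) : b = c := by
  by_contra hbc
  have h1 := hb.2.2.2 c hc.2.1
  have h2 := hc.2.2.2 b hb.2.1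
  rw [orientation_swap] at h2
  exact hS.orientation_ne_zero hb.1 hb.2.1 hc.2.1 hb.2.2.1 hbc hc.2.2.1.symm (by linarith)

theorem InStrictlyConvexPosition.isHullEdge_left_unique {S : Finset Plane}
    (hS : InStrictlyConvexPosition S) {a b c : Plane} (ha : IsHullEdge S a c)
    (hb : IsHullEdge S b c) : a = b := by
  by_contra hab
  have h1 := ha.2.2.2 b hb.1
  have h2 := hb.2.2.2 a ha.1
  rw [orientation_rotate a b c, orientation_swap a c b] at h2
  exact hS.orientation_ne_zero ha.1 ha.2.1 hb.1 ha.2.2.1 hb.2.2.1.symm (Ne.symm hab)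
    (by linarith)

/-- Two sides of a minimum-area triangle cannot both fail to be hull edges. -/
theorem InStrictlyConvexPosition.isHullEdge_or_isHullEdge {S : Finset Plane}
    (hS : InStrictlyConvexPosition S) {a b c : Plane} (ha : a ∈ S) (hb : b ∈ S) (hc : c ∈ S)
    (habc : 0 < orientation a b c)
    (hmin : ∀ x ∈ S, ∀ y ∈ S, ∀ z ∈ S, 0 < orientation x y z →
      orientation a b c ≤ orientation x y z) :
    IsHullEdge S a b ∨ IsHullEdge S b c := by
  obtain ⟨hab, hbc, hca⟩ := ne_of_orientation_ne_zero habc.ne'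
  by_contra! hcon
  obtain ⟨x, hx, hxneg⟩ : ∃ x ∈ S, orientation a b x < 0 := by
    by_contra! h
    exact hcon.1 ⟨ha, hb, hab, h⟩
  obtain ⟨y, hy, hyneg⟩ : ∃ y ∈ S, orientation b c y < 0 := by
    by_contra! h
    exact hcon.2 ⟨hb, hc, hbc, h⟩
  have hXpos := hS.orientation_pos ha hb hc hx habc hxneg
  -- The mirror image of `orientation_pos`, with the opposite cone at `c` instead of `a`.
  have hYpos : 0 < orientation c a y := by
    by_contra! hneg
    have hadd := orientation_add a b c y
    have h0 := orientation_barycentric a b c y 0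
    have h1 := orientation_barycentric a b c y 1
    obtain ⟨-, hcy, -⟩ := ne_of_orientation_ne_zero hyneg.ne
    refine hS.not_weighted_mean hc hy hb ha ha hcy.symm hbc hca.symm hca.symm
      (α := orientation a b c) (β := -orientation c a y) (γ := -orientation b c y) (δ := 0)
      (by linarith) (by linarith) (by linarith) le_rfl (by linarith) ?_ ?_
    · rw [← hadd] at h0 ⊢; linarith
    · rw [← hadd] at h1 ⊢; linarith
  -- By minimality `x` and `y` are no closer to line `c a` than `b` is, so the weights on `a` and
  -- `c` below are nonnegative.
  have hX := hmin c hc a ha x hx hXpos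
  have hY := hmin c hc a ha y hy hYpos
  obtain ⟨-, hbx, -⟩ := ne_of_orientation_ne_zero hxneg.ne
  obtain ⟨-, -, hyb⟩ := ne_of_orientation_ne_zero hyneg.ne
  have hXadd := orientation_add a b c x
  have hYadd := orientation_add a b c y
  -- Each barycentric identity is scaled by the other point's negative coordinate, so that the cross
  -- terms in `a` and `c` cancel.
  have hmean : ∀ i, -orientation b c y * orientation a b c * x i
      + -orientation b c y * (orientation c a x - orientation a b c) * a i
      + -orientation a b x * orientation a b c * y i
      + -orientation a b x * (orientation c a y - orientation a b c) * c i
      = (-orientation b c y * orientation a b c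
      + -orientation b c y * (orientation c a x - orientation a b c)
      + -orientation a b x * orientation a b c
      + -orientation a b x * (orientation c a y - orientation a b c)) * b i := by
    intro i
    linear_combination
      (orientation b c y) * orientation_barycentric a b c x i +
      (orientation a b x) * orientation_barycentric a b c y i
      - (orientation b c y) * a i * hXadd - (orientation a b x) * c i * hYadd
  have hy' : 0 < -orientation b c y := by linarith
  have hx' : 0 < -orientation a b x := by linarith
  have hX' : 0 ≤ orientation c a x - orientation a b c := by linarith
  have hY' : 0 ≤ orientation c a y - orientation a b c := by linarith
  exact hS.not_weighted_mean hb hx ha hy hc hbx.symm hab hyb hbc.symm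
    (by positivity) (by positivity) (by positivity) (by positivity) (by positivity)
    (hmean 0) (hmean 1)

/-- `T` consists of three consecutive vertices of the convex hull of `S`, with middle one `q`. -/
def IsConsecutiveTriple (S T : Finset Plane) (q : Plane) : Prop :=
  ∃ p r, (T : Set Plane) = {p, q, r} ∧ IsHullEdge S p q ∧ IsHullEdge S q r

theorem InStrictlyConvexPosition.exists_isConsecutiveTriple {S T : Finset Plane}
    (hS : InStrictlyConvexPosition S) (hT : IsMinAreaTriangle S T) :
    ∃ q ∈ S, IsConsecutiveTriple S T q := by
  obtain ⟨a, ha, b, hb, c, hc, hTabc, hpos, hmin⟩ : ∃ a ∈ S, ∃ b ∈ S, ∃ c ∈ S,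
      (T : Set Plane) = {a, b, c} ∧ 0 < orientation a b c ∧
      ∀ x ∈ S, ∀ y ∈ S, ∀ z ∈ S, 0 < orientation x y z →
        orientation a b c ≤ orientation x y z := by
    obtain ⟨a, ha, b, hb, c, hc, hTabc, hpos, hmin⟩ := hT
    simp only [triangleArea_eq] at hpos hmin
    have hmin' : ∀ x ∈ S, ∀ y ∈ S, ∀ z ∈ S, 0 < orientation x y z →
        |orientation a b c| ≤ orientation x y z := by
      intro x hx y hy z hz hxyz
      have := hmin x hx y hy z hz (by rw [abs_of_pos hxyz]; linarith)
      rw [abs_of_pos hxyz] at this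
      linarith
    have hne : orientation a b c ≠ 0 := by
      intro h
      simp [h] at hpos
    rcases hne.lt_or_gt with h | h
    · refine ⟨a, ha, c, hc, b, hb, ?_, ?_, ?_⟩
      · rw [hTabc, Set.pair_comm b c]
      · rw [orientation_swap]; linarith
      · rw [orientation_swap, ← abs_of_neg h]; exact hmin'
    · exact ⟨a, ha, b, hb, c, hc, hTabc, h, by rwa [abs_of_pos h] at hmin'⟩
  have h1 : orientation b c a = orientation a b c := orientation_rotate a b c
  have h2 : orientation c a b = orientation a b c := by rw [orientation_rotate, h1]
  -- Among any two sides one is a hull edge, so at most one side of the three is not.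
  have hab_bc := hS.isHullEdge_or_isHullEdge ha hb hc hpos hmin
  have hbc_ca := hS.isHullEdge_or_isHullEdge hb hc ha (h1 ▸ hpos) (h1 ▸ hmin)
  have hca_ab := hS.isHullEdge_or_isHullEdge hc ha hb (h2 ▸ hpos) (h2 ▸ hmin)
  have hTbca : (T : Set Plane) = {b, c, a} := by rw [hTabc]; ext; simp; tauto
  have hTcab : (T : Set Plane) = {c, a, b} := by rw [hTabc]; ext; simp; tauto
  by_cases hab : IsHullEdge S a b
  · by_cases hbc : IsHullEdge S b c
    · exact ⟨b, hb, a, c, hTabc, hab, hbc⟩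
    · exact ⟨a, ha, c, b, hTcab, hbc_ca.resolve_left hbc, hab⟩
  · exact ⟨c, hc, b, a, hTbca, hab_bc.resolve_left hab, hca_ab.resolve_right hab⟩

theorem mem_minAreaTriangles {S T : Finset Plane} :
    T ∈ minAreaTriangles S ↔ IsMinAreaTriangle S T := by
  simp only [minAreaTriangles, Finset.mem_filter, Finset.mem_powerset, and_iff_right_iff_imp]
  rintro ⟨a, ha, b, hb, c, hc, hT, -⟩
  rw [← Finset.coe_subset, hT]
  rintro x (rfl | rfl | rfl) <;> assumption

theorem InStrictlyConvexPosition.card_minAreaTriangles_le {S : Finset Plane}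
    (hS : InStrictlyConvexPosition S) : (minAreaTriangles S).card ≤ S.card := by
  refine Finset.card_le_card_of_forall_subsingleton (IsConsecutiveTriple S)
    (fun T hT => hS.exists_isConsecutiveTriple (mem_minAreaTriangles.1 hT)) ?_
  rintro q - T ⟨-, p, r, hT, hpq, hqr⟩ T' ⟨-, p', r', hT', hpq', hqr'⟩
  obtain rfl := hS.isHullEdge_left_unique hpq hpq'
  obtain rfl := hS.isHullEdge_right_unique hqr hqr'
  exact Finset.coe_injective (hT.trans hT'.symm)

/-! ### Areas of inscribed triangles and sine estimates. -/

/-- This is sin 2u + sin 2v − sin 2(u+v) = 4 sin u sin v sin(u+v). The doubled parameters make each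
factor, up to sign, half a chord length. -/
theorem orientation_cos_sin (x y z : ℝ) :
    orientation !₂[Real.cos (2 * x), Real.sin (2 * x)] !₂[Real.cos (2 * y), Real.sin (2 * y)]
        !₂[Real.cos (2 * z), Real.sin (2 * z)] =
      4 * Real.sin (y - x) * Real.sin (z - y) * Real.sin (z - x) := by
  have h1 : orientation !₂[Real.cos (2 * x), Real.sin (2 * x)]
      !₂[Real.cos (2 * y), Real.sin (2 * y)] !₂[Real.cos (2 * z), Real.sin (2 * z)] =
      Real.sin (2 * (y - x)) + Real.sin (2 * (z - y)) - Real.sin (2 * (z - x)) := by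
    simp only [orientation, mul_sub, Real.sin_sub, Matrix.cons_val_zero, Matrix.cons_val_one]
    ring
  rw [h1, show z - x = (y - x) + (z - y) by ring]
  generalize y - x = u
  generalize z - y = v
  rw [Real.sin_two_mul, Real.sin_two_mul, Real.sin_two_mul, Real.sin_add, Real.cos_add]
  linear_combination (-2 * Real.sin v * Real.cos v) * Real.sin_sq_add_cos_sq u -
    (2 * Real.sin u * Real.cos u) * Real.sin_sq_add_cos_sq v

/-- The vertices of the regular `n`-gon, indexed periodically by the integers. -/
noncomputable def polygonVertex (n : ℕ) (k : ℤ) : Plane :=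
  !₂[Real.cos (2 * Real.pi * k / n), Real.sin (2 * Real.pi * k / n)]

theorem orientation_polygonVertex (n : ℕ) (i j k : ℤ) :
    orientation (polygonVertex n i) (polygonVertex n j) (polygonVertex n k) =
      4 * Real.sin (Real.pi * (j - i : ℤ) / n) * Real.sin (Real.pi * (k - j : ℤ) / n) *
        Real.sin (Real.pi * (k - i : ℤ) / n) := by
  have h : ∀ m : ℤ, 2 * Real.pi * m / n = 2 * (Real.pi * m / n) := fun m => by ring
  have hs : ∀ l m : ℤ, Real.pi * (l - m : ℤ) / n = Real.pi * l / n - Real.pi * m / n := by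
    intro l m
    push_cast
    ring
  rw [hs, hs, hs]
  simp only [polygonVertex, h]
  exact orientation_cos_sin _ _ _

theorem abs_sin_pi_mul_emod (n : ℕ) (hn : 0 < n) (m : ℤ) :
    |Real.sin (Real.pi * m / n)| = Real.sin (Real.pi * (m % n : ℤ) / n) := by
  have hn' : (0 : ℝ) < n := by exact_mod_cast hn
  have hr0 : (0 : ℝ) ≤ (m % n : ℤ) := by
    exact_mod_cast Int.emod_nonneg m (by omega)
  have hr1 : ((m % n : ℤ) : ℝ) ≤ n := by
    exact_mod_cast (Int.emod_lt_of_pos m (by omega : (0 : ℤ) < n)).le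
  have hm : (m : ℝ) = (m % n : ℤ) + n * (m / n : ℤ) := by
    exact_mod_cast (Int.emod_add_mul_ediv m n).symm
  have hsin : 0 ≤ Real.sin (Real.pi * (m % n : ℤ) / n) := by
    refine Real.sin_nonneg_of_nonneg_of_le_pi (by positivity) ?_
    rw [div_le_iff₀ hn']
    gcongr
  have harg : Real.pi * m / n = Real.pi * (m % n : ℤ) / n + (m / n : ℤ) * Real.pi := by
    rw [hm]
    field_simp
  rw [harg, Real.sin_add_int_mul_pi, abs_mul, abs_zpow, abs_neg, abs_one, one_zpow, one_mul,
    abs_of_nonneg hsin]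

/-- Sine increases on [0, π/2] and is symmetric about π/2, so values of `m` past `n / 2` are
reflected to `n - m`. -/
theorem sin_pi_mul_le_sin_pi_mul (n : ℕ) (hn : 0 < n) {l m : ℝ} (hl : 0 ≤ l) (hlm : l ≤ m)
    (hm : m ≤ n - l) : Real.sin (Real.pi * l / n) ≤ Real.sin (Real.pi * m / n) := by
  have hn' : (0 : ℝ) < n := by exact_mod_cast hn
  have hpi := Real.pi_pos
  have hle : ∀ t : ℝ, l ≤ t → t ≤ n / 2 →
      Real.sin (Real.pi * l / n) ≤ Real.sin (Real.pi * t / n) := by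
    intro t hlt ht
    refine Real.sin_le_sin_of_le_of_le_pi_div_two ?_ ?_ ?_
    · have : 0 ≤ Real.pi * l / n := by positivity
      linarith
    · rw [div_le_iff₀ hn']
      nlinarith
    · gcongr
  rcases le_total m (n / 2) with h | h
  · exact hle m hlm h
  · have h2 := hle (n - m) (by linarith) (by linarith)
    rwa [show Real.pi * (n - m) / n = Real.pi - Real.pi * m / n by field_simp,
      Real.sin_pi_sub] at h2

theorem abs_sin_one_le (n : ℕ) (hn : 0 < n) {m : ℤ} (hm : ¬ (n : ℤ) ∣ m) :
    Real.sin (Real.pi * 1 / n) ≤ |Real.sin (Real.pi * m / n)| := by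
  rw [abs_sin_pi_mul_emod n hn]
  have h0 := Int.emod_nonneg m (by omega : (n : ℤ) ≠ 0)
  have h1 := Int.emod_lt_of_pos m (by omega : (0 : ℤ) < n)
  have h2 : m % n ≠ 0 := fun h => hm (Int.dvd_of_emod_eq_zero h)
  refine sin_pi_mul_le_sin_pi_mul n hn zero_le_one ?_ ?_
  · exact_mod_cast (by omega : 1 ≤ m % n)
  · have : m % n + 1 ≤ n := by omega
    have : ((m % n : ℤ) : ℝ) + 1 ≤ n := by exact_mod_cast this
    linarith

theorem abs_sin_two_le (n : ℕ) (hn : 0 < n) {m : ℤ} (hm : ¬ (n : ℤ) ∣ m)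
    (hm1 : ¬ (n : ℤ) ∣ m - 1) (hm2 : ¬ (n : ℤ) ∣ m + 1) :
    Real.sin (Real.pi * 2 / n) ≤ |Real.sin (Real.pi * m / n)| := by
  rw [abs_sin_pi_mul_emod n hn]
  have h0 := Int.emod_nonneg m (by omega : (n : ℤ) ≠ 0)
  have h1 := Int.emod_lt_of_pos m (by omega : (0 : ℤ) < n)
  have h2 : m % n ≠ 0 := fun h => hm (Int.dvd_of_emod_eq_zero h)
  have hd := Int.emod_add_mul_ediv m n
  have h3 : m % n ≠ 1 := fun h => hm1 ⟨m / n, by linarith⟩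
  have h4 : m % n ≠ n - 1 := fun h => hm2 ⟨m / n + 1, by linarith⟩
  refine sin_pi_mul_le_sin_pi_mul n hn zero_le_two ?_ ?_
  · exact_mod_cast (by omega : 2 ≤ m % n)
  · have : m % n + 2 ≤ n := by omega
    have : ((m % n : ℤ) : ℝ) + 2 ≤ n := by exact_mod_cast this
    linarith

theorem sin_pi_one_pos (n : ℕ) (hn : 3 ≤ n) : 0 < Real.sin (Real.pi * 1 / n) := by
  have hn' : (3 : ℝ) ≤ n := by exact_mod_cast hn
  have hpi := Real.pi_pos
  refine Real.sin_pos_of_pos_of_lt_pi (by positivity) ?_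
  rw [div_lt_iff₀ (by linarith)]
  nlinarith

theorem sin_pi_two_pos (n : ℕ) (hn : 3 ≤ n) : 0 < Real.sin (Real.pi * 2 / n) := by
  have hn' : (3 : ℝ) ≤ n := by exact_mod_cast hn
  have hpi := Real.pi_pos
  refine Real.sin_pos_of_pos_of_lt_pi (by positivity) ?_
  rw [div_lt_iff₀ (by linarith)]
  nlinarith

theorem sin_eq_zero_of_dvd {n : ℕ} (hn : 0 < n) {m : ℤ} (h : (n : ℤ) ∣ m) :
    Real.sin (Real.pi * m / n) = 0 := by
  have := abs_sin_pi_mul_emod n hn m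
  rw [Int.emod_eq_zero_of_dvd h] at this
  simpa using this

/-! ### Vertices of the regular polygon and their convex position. -/

theorem polygonVertex_eq_iff {n : ℕ} (hn : 0 < n) {i j : ℤ} :
    polygonVertex n i = polygonVertex n j ↔ (n : ℤ) ∣ i - j := by
  have hn' : (n : ℝ) ≠ 0 := by positivity
  have hpi := Real.pi_ne_zero
  constructor
  · intro h
    have h0 : Real.cos (2 * Real.pi * i / n) = Real.cos (2 * Real.pi * j / n) :=
      congrArg (fun p : Plane => p 0) h
    have h1 : Real.sin (2 * Real.pi * i / n) = Real.sin (2 * Real.pi * j / n) :=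
      congrArg (fun p : Plane => p 1) h
    have hcos : Real.cos (2 * Real.pi * i / n - 2 * Real.pi * j / n) = 1 := by
      rw [Real.cos_sub, h0, h1, ← Real.cos_sq_add_sin_sq (2 * Real.pi * j / n)]
      ring
    obtain ⟨k, hk⟩ := (Real.cos_eq_one_iff _).1 hcos
    refine ⟨k, ?_⟩
    field_simp at hk
    have : (i : ℝ) - j = n * k := by linarith
    exact_mod_cast this
  · rintro ⟨k, hk⟩
    have hi : (i : ℝ) = j + n * k := by
      have : i = j + n * k := by linarith
      exact_mod_cast this
    have : 2 * Real.pi * i / n = 2 * Real.pi * j / n + k * (2 * Real.pi) := by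
      rw [hi]
      field_simp
    simp only [polygonVertex, this, Real.cos_add_int_mul_two_pi, Real.sin_add_int_mul_two_pi]

open Classical in
theorem regularPolygon_eq_image (n : ℕ) :
    regularPolygon n = (Finset.range n).image fun k : ℕ => polygonVertex n k := by
  ext p
  simp [regularPolygon, polygonVertex]

theorem mem_regularPolygon {n : ℕ} (hn : 0 < n) {p : Plane} :
    p ∈ regularPolygon n ↔ ∃ i : ℤ, p = polygonVertex n i := by
  simp only [regularPolygon_eq_image, Finset.mem_image, Finset.mem_range]
  constructor
  · rintro ⟨k, -, rfl⟩
    exact ⟨k, rfl⟩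
  · rintro ⟨i, rfl⟩
    have h0 := Int.emod_nonneg i (by omega : (n : ℤ) ≠ 0)
    have h1 := Int.emod_lt_of_pos i (by omega : (0 : ℤ) < n)
    refine ⟨(i % n).toNat, by omega, ?_⟩
    rw [Int.toNat_of_nonneg h0]
    exact (polygonVertex_eq_iff hn).2 (Int.mod_modEq i n).symm.dvd

theorem card_regularPolygon {n : ℕ} (hn : 0 < n) : (regularPolygon n).card = n := by
  rw [regularPolygon_eq_image, Finset.card_image_of_injOn, Finset.card_range]
  intro i hi j hj hij
  simp only [Finset.coe_range, Set.mem_Iio] at hi hj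
  have h : polygonVertex n (i : ℤ) = polygonVertex n (j : ℤ) := hij
  have hlt := Int.eq_zero_of_abs_lt_dvd ((polygonVertex_eq_iff hn).1 h)
    (by rw [abs_lt]; omega)
  omega

/-- A finite subset of the unit circle is in strictly convex position. -/
theorem inStrictlyConvexPosition_of_unit {S : Finset Plane}
    (h : ∀ p ∈ S, p 0 ^ 2 + p 1 ^ 2 = 1) : InStrictlyConvexPosition S := by
  rw [inStrictlyConvexPosition_iff]
  intro v hv hmem
  -- The tangent at `v` separates: every other unit vector has inner product less than 1 with `v`.
  have hconv : Convex ℝ {p : Plane | p 0 * v 0 + p 1 * v 1 < 1} := by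
    refine convex_halfSpace_lt ⟨?_, ?_⟩ 1
    · intro x y; simp; ring
    · intro c x; simp; ring
  have hsub : (S : Set Plane) \ {v} ⊆ {p : Plane | p 0 * v 0 + p 1 * v 1 < 1} := by
    rintro p ⟨hp, hpv⟩
    have hp1 := h p hp
    have hv1 := h v hv
    by_contra hge
    simp only [Set.mem_ofPred_eq, not_lt] at hge
    have h0 : p 0 - v 0 = 0 := by
      nlinarith [sq_nonneg (p 0 - v 0), sq_nonneg (p 1 - v 1)]
    have h1 : p 1 - v 1 = 0 := by
      nlinarith [sq_nonneg (p 0 - v 0), sq_nonneg (p 1 - v 1)]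
    refine hpv ?_
    ext i
    fin_cases i
    · simpa using sub_eq_zero.1 h0
    · simpa using sub_eq_zero.1 h1
  have := convexHull_min hsub hconv hmem
  simp only [Set.mem_ofPred_eq] at this
  nlinarith [h v hv]

theorem inStrictlyConvexPosition_regularPolygon (n : ℕ) :
    InStrictlyConvexPosition (regularPolygon n) := by
  refine inStrictlyConvexPosition_of_unit fun p hp => ?_
  simp only [regularPolygon_eq_image, Finset.mem_image] at hp
  obtain ⟨k, -, rfl⟩ := hp
  simp [polygonVertex]

/-! ### Minimum-area triangles of the regular polygon. -/

open Classical in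
/-- The triple of consecutive vertices of the regular `n`-gon with middle vertex `i`. -/
noncomputable def polygonTriple (n : ℕ) (i : ℤ) : Finset Plane :=
  {polygonVertex n (i - 1), polygonVertex n i, polygonVertex n (i + 1)}

theorem triangleArea_polygonVertex_consecutive (n : ℕ) (hn : 3 ≤ n) (i : ℤ) :
    triangleArea (polygonVertex n (i - 1)) (polygonVertex n i) (polygonVertex n (i + 1)) =
      2 * (Real.sin (Real.pi * 1 / n) * Real.sin (Real.pi * 1 / n) *
        Real.sin (Real.pi * 2 / n)) := by
  have h1 := sin_pi_one_pos n hn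
  have h2 := sin_pi_two_pos n hn
  rw [triangleArea_eq, orientation_polygonVertex, show i - (i - 1) = 1 by ring,
    show i + 1 - i = 1 by ring, show i + 1 - (i - 1) = 2 by ring]
  push_cast
  rw [abs_of_pos (by positivity)]
  ring

theorem isMinAreaTriangle_polygonTriple {n : ℕ} (hn : 3 ≤ n) (i : ℤ) :
    IsMinAreaTriangle (regularPolygon n) (polygonTriple n i) := by
  have hn0 : 0 < n := by omega
  have h1 := sin_pi_one_pos n hn
  have h2 := sin_pi_two_pos n hn
  have hmem : ∀ k, polygonVertex n k ∈ regularPolygon n := fun k =>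
    (mem_regularPolygon hn0).2 ⟨k, rfl⟩
  refine ⟨_, hmem (i - 1), _, hmem i, _, hmem (i + 1), by simp [polygonTriple], ?_, ?_⟩
  · rw [triangleArea_polygonVertex_consecutive n hn]
    positivity
  intro x hx y hy z hz hpos
  obtain ⟨j, rfl⟩ := (mem_regularPolygon hn0).1 hx
  obtain ⟨k, rfl⟩ := (mem_regularPolygon hn0).1 hy
  obtain ⟨l, rfl⟩ := (mem_regularPolygon hn0).1 hz
  rw [triangleArea_polygonVertex_consecutive n hn]
  rw [triangleArea_eq, orientation_polygonVertex] at hpos ⊢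
  have ha : ¬ (n : ℤ) ∣ k - j := fun h => by
    rw [sin_eq_zero_of_dvd hn0 h] at hpos
    simp at hpos
  have hb : ¬ (n : ℤ) ∣ l - k := fun h => by
    rw [sin_eq_zero_of_dvd hn0 h] at hpos
    simp at hpos
  have hc : ¬ (n : ℤ) ∣ l - j := fun h => by
    rw [sin_eq_zero_of_dvd hn0 h] at hpos
    simp at hpos
  have hsum : l - j = (k - j) + (l - k) := by ring
  rw [abs_mul, abs_mul, abs_mul, abs_of_pos (by norm_num : (0 : ℝ) < 4)]
  generalize k - j = a at *
  generalize l - k = b at *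
  generalize l - j = c at *
  have ha1 := abs_sin_one_le n hn0 ha
  have hb1 := abs_sin_one_le n hn0 hb
  have hc1 := abs_sin_one_le n hn0 hc
  -- If all three steps were ±1 modulo `n`, then `a + b - c = 0` would make `n` divide ±1 or ±3, so
  -- `n = 3`; but there the chords of step 1 and 2 are equal.
  have hor : Real.sin (Real.pi * 2 / n) ≤ |Real.sin (Real.pi * a / n)| ∨
      Real.sin (Real.pi * 2 / n) ≤ |Real.sin (Real.pi * b / n)| ∨
      Real.sin (Real.pi * 2 / n) ≤ |Real.sin (Real.pi * c / n)| := by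
    by_contra! hcon
    have key : ∀ m : ℤ, ¬ (n : ℤ) ∣ m →
        |Real.sin (Real.pi * m / n)| < Real.sin (Real.pi * 2 / n) →
        (n : ℤ) ∣ m - 1 ∨ (n : ℤ) ∣ m + 1 := by
      intro m hm hlt
      by_contra! hm'
      exact (abs_sin_two_le n hn0 hm hm'.1 hm'.2).not_gt hlt
    have hd : ∀ m : ℤ, m ≠ 0 → |m| ≤ 3 → (n : ℤ) ∣ m → n = 3 := by
      intro m hm0 hm3 hdvd
      have := Int.le_of_dvd (abs_pos.2 hm0) ((dvd_abs _ _).2 hdvd)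
      omega
    have h3 : n = 3 := by
      rcases key a ha hcon.1 with h | h <;> rcases key b hb hcon.2.1 with h' | h' <;>
        rcases key c hc hcon.2.2 with h'' | h'' <;>
        have hs := dvd_sub (dvd_add h h') h'' <;> rw [hsum] at hs <;> ring_nf at hs
      all_goals exact hd _ (by norm_num) (by norm_num) hs
    subst h3
    have hlt := hcon.1
    rw [show Real.pi * 2 / (3 : ℕ) = Real.pi - Real.pi * 1 / (3 : ℕ) by push_cast; ring,
      Real.sin_pi_sub] at hlt
    linarith
  generalize |Real.sin (Real.pi * a / n)| = A at *
  generalize |Real.sin (Real.pi * b / n)| = B at *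
  generalize |Real.sin (Real.pi * c / n)| = D at *
  generalize Real.sin (Real.pi * 1 / n) = s at *
  generalize Real.sin (Real.pi * 2 / n) = t at *
  have hA : 0 < A := by linarith
  have hB : 0 < B := by linarith
  have hD : 0 < D := by linarith
  have key : s * s * t ≤ A * B * D := by
    rcases hor with h | h | h
    · calc s * s * t ≤ B * D * A := by gcongr
        _ = A * B * D := by ring
    · calc s * s * t ≤ A * D * B := by gcongr
        _ = A * B * D := by ring
    · gcongr
  linarith

/-- If the middles differ modulo `n`, the middle `i` is an end of the triple at `j`, and the
neighbour of `i` on the outer side must again be in that triple. This forces `n` to divide 1, 2 or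
3. For `n = 3` all the triples coincide. -/
theorem polygonTriple_injOn {n : ℕ} (hn : 4 ≤ n) :
    Set.InjOn (fun i : ℕ => polygonTriple n i) (Finset.range n) := by
  intro i hi j hj hij
  have hn0 : 0 < n := by omega
  simp only [Finset.coe_range, Set.mem_Iio] at hi hj
  have hnd : ∀ m : ℤ, 0 < m → m < 4 → ¬ (n : ℤ) ∣ m := fun m h0 h4 h => by
    have := Int.le_of_dvd h0 h
    omega
  have hsub : ∀ d : ℤ, polygonVertex n d ∈ polygonTriple n j →
      (n : ℤ) ∣ d - (j - 1) ∨ (n : ℤ) ∣ d - j ∨ (n : ℤ) ∣ d - (j + 1) := by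
    intro d hd
    simpa [polygonTriple, polygonVertex_eq_iff hn0] using hd
  have hij' : polygonTriple n i = polygonTriple n j := hij
  have hm := hsub (i - 1) (hij' ▸ by simp [polygonTriple])
  have h0 := hsub i (hij' ▸ by simp [polygonTriple])
  have hp := hsub (i + 1) (hij' ▸ by simp [polygonTriple])
  have hdvd : (n : ℤ) ∣ (i : ℤ) - j := by
    rcases h0 with h | h | h
    · exfalso
      rcases hm with h' | h' | h' <;> have h3 := dvd_sub h h' <;> ring_nf at h3
      all_goals exact hnd _ (by norm_num) (by norm_num) h3
    · exact h
    · exfalso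
      rcases hp with h' | h' | h' <;> have h3 := dvd_sub h' h <;> ring_nf at h3
      all_goals exact hnd _ (by norm_num) (by norm_num) h3
  have := Int.eq_zero_of_abs_lt_dvd hdvd (by rw [abs_lt]; omega)
  omega

theorem card_minAreaTriangles_regularPolygon {n : ℕ} (hn : 4 ≤ n) :
    (minAreaTriangles (regularPolygon n)).card = n := by
  classical
  apply le_antisymm
  · exact (inStrictlyConvexPosition_regularPolygon n).card_minAreaTriangles_le.trans_eq
      (card_regularPolygon (by omega))
  · calc n = ((Finset.range n).image fun i : ℕ => polygonTriple n i).card := by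
          rw [Finset.card_image_of_injOn (polygonTriple_injOn hn), Finset.card_range]
      _ ≤ _ := by
          refine Finset.card_le_card fun T hT => ?_
          obtain ⟨i, -, rfl⟩ := Finset.mem_image.1 hT
          exact mem_minAreaTriangles.2 (isMinAreaTriangle_polygonTriple (by omega) i)

theorem theorem5 :
    (∃ C : ℝ, ∀ S : Finset Plane, InStrictlyConvexPosition S →
      ((minAreaTriangles S).card : ℝ) ≤ C * (S.card : ℝ)) ∧
    (∃ c : ℝ, 0 < c ∧ ∀ n : ℕ, 3 ≤ n → ∃ S : Finset Plane, S.card = n ∧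
      InStrictlyConvexPosition S ∧ c * (n : ℝ) ≤ ((minAreaTriangles S).card : ℝ)) ∧
    (∀ n : ℕ, 4 ≤ n → (regularPolygon n).card = n ∧
      InStrictlyConvexPosition (regularPolygon n) ∧
      (minAreaTriangles (regularPolygon n)).card = n) := by
  -- The constant 1/3 is dictated by `n = 3`, where there is a single triangle; from `n = 4` on the
  -- count is `n`.
  refine ⟨⟨1, fun S hS => ?_⟩, ⟨1 / 3, by norm_num, fun n hn => ⟨regularPolygon n,
    card_regularPolygon (by omega), inStrictlyConvexPosition_regularPolygon n, ?_⟩⟩,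
    fun n hn => ⟨card_regularPolygon (by omega), inStrictlyConvexPosition_regularPolygon n,
      card_minAreaTriangles_regularPolygon hn⟩⟩
  · rw [one_mul]
    exact_mod_cast hS.card_minAreaTriangles_le
  · rcases hn.eq_or_lt with rfl | hn'
    · have hpos : 0 < (minAreaTriangles (regularPolygon 3)).card :=
        Finset.card_pos.2
          ⟨_, mem_minAreaTriangles.2 (isMinAreaTriangle_polygonTriple le_rfl 0)⟩
      have : (1 : ℝ) ≤ (minAreaTriangles (regularPolygon 3)).card := by exact_mod_cast hpos
      norm_num
      exact Finset.card_pos.1 hpos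
    · rw [card_minAreaTriangles_regularPolygon hn']
      have : (0 : ℝ) ≤ n := n.cast_nonneg
      linarith
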